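/- Let $d \ge 0$ and let $\mathcal A$ be a $*$-subalgebra of $\mathcal B(\mathbb C^d) = M_d(\mathbb C)$, that is, a complex linear subspace closed under matrix multiplication and under the adjoint $A \mapsto A^\dagger$ (it need not contain the identity matrix). Then there are integers $N \ge 0$, $d_0 \ge 0$ and $m_1,\dots,m_N, n_1,\dots,n_N \ge 1$ with $\sum_{i=1}^N n_i m_i + d_0 = d$, and a unitary matrix $U \in M_d(\mathbb C)$, such that $$U \mathcal A U^\dagger = \Bigl[\bigoplus_{i=1}^N \mathbb 1_{m_i} \otimes M_{n_i}(\mathbb C)\Bigr] \oplus 0_{d_0},$$ where the right-hand side is the set of all block diagonal $d \times d$ matrices with diagonal blocks $\mathbb 1_{m_1}\otimes X_1, \dots, \mathbb 1_{m_N} \otimes X_N, 0_{d_0}$, the $X_i \in M_{n_i}(\mathbb C)$ being arbitrary, $\otimes$ is the Kronecker product, $\mathbb 1_{m}$ is the $m\times m$ identity matrix and $0_{d_0}$ is the $d_0 \times d_0$ zero matrix. Moreover, for every such decomposition of $\mathcal A$ (even if some of the $m_i$, $n_i$ are allowed to be $0$), the center $\mathcal Z(\mathcal A) = \{A \in \mathcal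 A : AB = BA \text{ for all } B \in \mathcal A\}$ is the set of all matrices $$U^\dagger \Bigl(\Bigl[\bigoplus_{i=1}^N \alpha_i\, \mathbb 1_{m_i} \otimes \mathbb 1_{n_i}\Bigr] \oplus 0_{d_0}\Bigr) U, \qquad \alpha_1, \dots, \alpha_N \in \mathbb C.$$ -/

import Mathlib

open scoped Matrix Kronecker

/-- The ordering of the coordinates in the block form: the blocks `0, …, N - 1` in this order, block
`i` being indexed by `Fin (m i) × Fin (n i)` in lexicographic order (the usual ordering for the
Kronecker product), followed by the `d₀` coordinates of the zero block. -/
def blockIndexEquiv {d N d₀ : ℕ} (m n : Fin N → ℕ) (hd : ∑ i, n i * m i + d₀ = d) :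
    (Σ i : Fin N, Fin (m i) × Fin (n i)) ⊕ Fin d₀ ≃ Fin d :=
  (Equiv.sumCongr
      ((Equiv.sigmaCongrRight fun _ => finProdFinEquiv).trans finSigmaFinEquiv)
      (Equiv.refl (Fin d₀))).trans
    (finSumFinEquiv.trans (finCongr (by simpa only [mul_comm] using hd)))

/-- The `d × d` block diagonal matrix
`(1_{m_0} ⊗ X_0) ⊕ ⋯ ⊕ (1_{m_{N-1}} ⊗ X_{N-1}) ⊕ 0_{d₀}`. -/
def blockSum {d N d₀ : ℕ} (m n : Fin N → ℕ) (hd : ∑ i, n i * m i + d₀ = d)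
    (X : (i : Fin N) → Matrix (Fin (n i)) (Fin (n i)) ℂ) : Matrix (Fin d) (Fin d) ℂ :=
  Matrix.reindex (blockIndexEquiv m n hd) (blockIndexEquiv m n hd)
    (Matrix.fromBlocks
      (Matrix.blockDiagonal' fun i => (1 : Matrix (Fin (m i)) (Fin (m i)) ℂ) ⊗ₖ X i) 0
      0 (0 : Matrix (Fin d₀) (Fin d₀) ℂ))

/-- `U 𝒜 U† = [⨁ i, 1_{m_i} ⊗ M_{n_i}(ℂ)] ⊕ 0_{d₀}`, as sets of matrices. -/
def IsBlockDecomposition {d N d₀ : ℕ}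
    (𝒜 : NonUnitalStarSubalgebra ℂ (Matrix (Fin d) (Fin d) ℂ))
    (U : Matrix.unitaryGroup (Fin d) ℂ) (m n : Fin N → ℕ)
    (hd : ∑ i, n i * m i + d₀ = d) : Prop :=
  (fun A : Matrix (Fin d) (Fin d) ℂ => (U : Matrix (Fin d) (Fin d) ℂ) * A *
      (U : Matrix (Fin d) (Fin d) ℂ)ᴴ) '' (𝒜 : Set (Matrix (Fin d) (Fin d) ℂ)) =
    Set.range (blockSum m n hd)

/-- The center of the algebra `𝒜` itself: the elements of `𝒜` that commute with all of `𝒜`. -/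
def algebraCenter {d : ℕ} (𝒜 : NonUnitalStarSubalgebra ℂ (Matrix (Fin d) (Fin d) ℂ)) :
    Set (Matrix (Fin d) (Fin d) ℂ) :=
  {A | A ∈ 𝒜 ∧ ∀ B ∈ 𝒜, A * B = B * A}

/-!
If `x ∈ 𝒜` is nonzero of minimal rank and `a ∈ 𝒜`, then `x a` maps the range of `x` to itself, and
for an eigenvalue `c` of this restriction `x a x - c x` has smaller rank, so that `x a x = c x`.
Normalizing `x⋆ x` therefore gives a projection `p ∈ 𝒜` with `p 𝒜 p = ℂ p`. On the left ideal `𝒜 p`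
one has `y⋆ z = ⟨y, z⟩ p` for an inner product `⟨·, ·⟩`; in an orthonormal basis `x₁, …, xₙ` of
`𝒜 p` the elements `xₖ xₗ⋆` are matrix units of the simple summand generated by `p`. Take a maximal
family of such projections `pᵢ` with `pᵢ 𝒜 pⱼ = 0` for `i ≠ j`: the matrix units then span `𝒜`. If
the columns of `Vᵢ` form an orthonormal basis of the range of `pᵢ`, those of all the `xᵢₖ Vᵢ` form
an orthonormal basis of the range of the unit of `𝒜`, on which `𝒜` acts as `⨁ i, 1 ⊗ M_{nᵢ}(ℂ)`; any
unitary extending it block diagonalizes `𝒜`.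
-/

section LinearAlgebra

open Matrix WithLp

theorem nonempty_of_matrix_mul_ne_zero {R ι κ ι' : Type*} [Fintype κ] [NonUnitalNonAssocSemiring R]
    {A : Matrix ι κ R} {B : Matrix κ ι' R} (h : A * B ≠ 0) : Nonempty κ := by
  refine not_isEmpty_iff.1 fun _ => h (Matrix.ext fun i j => ?_)
  rw [mul_apply, Finset.univ_eq_empty, Finset.sum_empty, Matrix.zero_apply]

theorem exists_rank_mul_mul_sub_smul_lt {K ι κ : Type*} [Field K] [IsAlgClosed K] [Fintype ι]
    [Fintype κ] {x : Matrix ι κ K} (hx : x ≠ 0) (a : Matrix κ ι K) :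
    ∃ c : K, (x * a * x - c • x).rank < x.rank := by
  classical
  let R := LinearMap.range x.mulVecLin
  have hR : ∀ w ∈ R, (x * a).mulVecLin w ∈ R := fun w _ => ⟨a *ᵥ w, by simp⟩
  have : Nontrivial R := by
    rw [Submodule.nontrivial_iff_ne_bot, Ne, LinearMap.range_eq_bot]
    exact fun h => hx (mulVec_injective (funext fun w => by simpa using LinearMap.congr_fun h w))
  obtain ⟨c, hc⟩ := Module.End.exists_eigenvalue ((x * a).mulVecLin.restrict hR)
  obtain ⟨⟨_, u, rfl⟩, hw, hw0⟩ := hc.exists_hasEigenvector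
  have hu : x *ᵥ u ≠ 0 := fun h => hw0 (Subtype.ext h)
  have hxu : (x * a) *ᵥ (x *ᵥ u) = c • (x *ᵥ u) :=
    congrArg Subtype.val (Module.End.mem_eigenspace_iff.1 hw)
  refine ⟨c, ?_⟩
  have hker : LinearMap.ker x.mulVecLin < LinearMap.ker (x * a * x - c • x).mulVecLin := by
    refine SetLike.lt_iff_le_and_exists.2 ⟨fun w hw => ?_, u, ?_, hu⟩
    · rw [LinearMap.mem_ker, mulVecLin_apply] at hw ⊢
      rw [sub_mulVec, smul_mulVec, ← mulVec_mulVec, hw, mulVec_zero, smul_zero, sub_zero]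
    · rw [LinearMap.mem_ker, mulVecLin_apply, sub_mulVec, smul_mulVec, ← mulVec_mulVec, hxu,
        sub_self]
  have hlt := Submodule.finrank_lt_finrank_of_lt hker
  have rank_nullity (y : Matrix ι κ K) :
      y.rank + Module.finrank K (LinearMap.ker y.mulVecLin) = Module.finrank K (κ → K) :=
    y.mulVecLin.finrank_range_add_finrank_ker
  have := rank_nullity x
  have := rank_nullity (x * a * x - c • x)
  omega

variable {𝕜 ι κ : Type*} [RCLike 𝕜] [Fintype ι]

theorem orthonormal_toLp_transpose_iff [DecidableEq κ] {W : Matrix ι κ 𝕜} :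
    Orthonormal 𝕜 (fun k => toLp 2 (Wᵀ k)) ↔ Wᴴ * W = 1 := by
  simp only [orthonormal_iff_ite, inner_matrix_col_col, ← Matrix.ext_iff, one_apply]

theorem exists_isometry_range_eq_submodule (S : Submodule 𝕜 (ι → 𝕜)) :
    ∃ (m : ℕ) (V : Matrix ι (Fin m) 𝕜),
      Vᴴ * V = 1 ∧ (∀ k, Vᵀ k ∈ S) ∧ ∀ w ∈ S, V *ᵥ (Vᴴ *ᵥ w) = w := by
  let b := stdOrthonormalBasis 𝕜 (S.comap (WithLp.linearEquiv 2 𝕜 (ι → 𝕜)).toLinearMap)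
  refine ⟨_, of fun a k => ofLp (b k).1 a, ?_, fun k => (b k).2, fun w hw => ?_⟩
  · exact orthonormal_toLp_transpose_iff.1
      (b.orthonormal.comp_linearIsometry (Submodule.subtypeₗᵢ _))
  · have hsum := congrArg (fun z => ofLp z.1) (b.sum_repr' ⟨toLp 2 w, hw⟩)
    ext a
    simpa [mulVec, dotProduct, PiLp.inner_apply, mul_comm] using congrFun hsum a

theorem exists_isometry_mul_conjTranspose_eq {p : Matrix ι ι 𝕜} (hp : IsStarProjection p) :
    ∃ (m : ℕ) (V : Matrix ι (Fin m) 𝕜), Vᴴ * V = 1 ∧ V * Vᴴ = p := by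
  classical
  obtain ⟨m, V, hV, hVp, hrange⟩ :=
    exists_isometry_range_eq_submodule (LinearMap.range p.mulVecLin)
  have hpV : p * V = V := by
    ext a k
    obtain ⟨w, hw⟩ := hVp k
    change (p *ᵥ Vᵀ k) a = Vᵀ k a
    rw [← hw, mulVecLin_apply, mulVec_mulVec, hp.isIdempotentElem.eq]
  have hVVp : V * Vᴴ * p = p := ext_of_mulVec_single fun i => by
    simpa only [mulVec_mulVec, Matrix.mul_assoc] using hrange (p *ᵥ Pi.single i 1) ⟨_, rfl⟩
  refine ⟨m, V, hV, ?_⟩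
  have hstar := congrArg conjTranspose hVVp
  rw [conjTranspose_mul, conjTranspose_mul, conjTranspose_conjTranspose, ← star_eq_conjTranspose,
    hp.isSelfAdjoint.star_eq, ← Matrix.mul_assoc, hpV] at hstar
  exact hstar

theorem card_le_of_conjTranspose_mul_self_eq_one [Fintype κ] [DecidableEq κ] {W : Matrix ι κ 𝕜}
    (hW : Wᴴ * W = 1) : Fintype.card κ ≤ Fintype.card ι := by
  simpa using (orthonormal_toLp_transpose_iff.2 hW).linearIndependent.fintype_card_le_finrank

theorem exists_fromCols_conjTranspose_mul_self_eq_one {κ' : Type*} [DecidableEq κ]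
    [DecidableEq κ'] (e : κ ⊕ κ' ≃ ι) {W : Matrix ι κ 𝕜} (hW : Wᴴ * W = 1) :
    ∃ W' : Matrix ι κ' 𝕜, (fromCols W W')ᴴ * fromCols W W' = 1 := by
  let v : κ ⊕ κ' → EuclideanSpace 𝕜 ι := Sum.elim (fun k => toLp 2 (Wᵀ k)) 0
  have hv : Orthonormal 𝕜 ((Set.range Sum.inl).domRestrict v) := by
    convert! (orthonormal_toLp_transpose_iff.2 hW).comp _
      (Equiv.ofInjective _ Sum.inl_injective).symm.injective
    ext ⟨_, k, rfl⟩
    simp [v]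
  have := Fintype.ofEquiv ι e.symm
  obtain ⟨b, hb⟩ := hv.exists_orthonormalBasis_extension_of_card_eq
    (by simpa using (Fintype.card_congr e).symm)
  let W' : Matrix ι κ' 𝕜 := of fun a k => b (Sum.inr k) a
  have hcols : (fun s => toLp 2 ((fromCols W W')ᵀ s)) = b := by
    ext (k | k) : 1
    · exact (hb _ ⟨k, rfl⟩).symm
    · rfl
  exact ⟨W', orthonormal_toLp_transpose_iff.1 (hcols ▸ b.orthonormal)⟩

theorem exists_unitary_conj_fromBlocks_eq {κ' : Type*} [Fintype κ] [DecidableEq ι] [DecidableEq κ]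
    (e : κ ⊕ κ' ≃ ι) {W : Matrix ι κ 𝕜} (hW : Wᴴ * W = 1) :
    ∃ U : unitaryGroup ι 𝕜, ∀ B : Matrix κ κ 𝕜,
      (U : Matrix ι ι 𝕜)ᴴ * reindex e e (fromBlocks B 0 0 0) * (U : Matrix ι ι 𝕜) =
        W * B * Wᴴ := by
  classical
  have := Fintype.ofInjective (e ∘ Sum.inr) (e.injective.comp Sum.inr_injective)
  obtain ⟨W', hWW'⟩ := exists_fromCols_conjTranspose_mul_self_eq_one e hW
  let U : Matrix ι ι 𝕜 := (fromCols W W')ᴴ.submatrix e.symm id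
  have hUstar : Uᴴ = (fromCols W W').submatrix id e.symm := by
    simp [U]
  have hU : U * Uᴴ = 1 := by
    rw [hUstar, ← submatrix_mul _ _ _ _ _ Function.bijective_id, hWW', submatrix_one_equiv]
  refine ⟨⟨U, mem_unitaryGroup_iff.2 hU⟩, fun B => ?_⟩
  change Uᴴ * _ * U = _
  rw [hUstar, reindex_apply, submatrix_mul_equiv, submatrix_mul_equiv, submatrix_id_id,
    fromCols_mul_fromBlocks, conjTranspose_fromCols_eq_fromRows_conjTranspose,
    fromCols_mul_fromRows]
  simp only [Matrix.mul_zero, add_zero, Matrix.zero_mul]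

end LinearAlgebra

section MinimalProjections

variable {R A κ : Type*} [CommRing R] [NonUnitalRing A] [StarRing A] [Module R A]

/-- A minimal projection of `𝒜`, in the algebraic sense that the corner `p 𝒜 p` consists of the
scalar multiples of `p`. -/
structure IsMinimalProjection (𝒜 : NonUnitalStarSubalgebra R A) (p : A) : Prop where
  mem : p ∈ 𝒜
  ne_zero : p ≠ 0
  isStarProjection : IsStarProjection p
  exists_eq_smul : ∀ a ∈ 𝒜, ∃ c : R, p * a * p = c • p

/-- A finite basis of the left ideal `𝒜 p` that is orthonormal for the `p 𝒜 p`-valued form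
`(y, z) ↦ y⋆ z`. For `𝒜 = M_n(ℂ)` and `p = E₁₁` the matrix units `E_{k1}` form one. -/
structure IsColumnBasis [Fintype κ] [DecidableEq κ] (𝒜 : NonUnitalStarSubalgebra R A) (p : A)
    (x : κ → A) : Prop where
  mem : ∀ k, x k ∈ 𝒜
  mul_eq_self : ∀ k, x k * p = x k
  star_mul : ∀ k l, star (x k) * x l = if k = l then p else 0
  sum_mul_star_mul : ∀ y ∈ 𝒜, y * p = y → ∑ k, x k * (star (x k) * y) = y

/-- A family of minimal projections, one for each simple summand of `𝒜`: distinct members are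
orthogonal through `𝒜`, and the two-sided ideal generated by the family has zero annihilator. -/
structure IsCompleteFamily (𝒜 : NonUnitalStarSubalgebra R A) (p : κ → A) : Prop where
  isMinimalProjection : ∀ i, IsMinimalProjection 𝒜 (p i)
  mul_mul_eq_zero : ∀ i j, i ≠ j → ∀ a ∈ 𝒜, p i * a * p j = 0
  eq_zero : ∀ a ∈ 𝒜, (∀ i, ∀ b ∈ 𝒜, a * b * p i = 0) → a = 0

variable {𝒜 : NonUnitalStarSubalgebra R A} {p q y z : A}

theorem star_mul_eq_mul_star_mul_mul (hp : IsSelfAdjoint p) (hy : y * p = y) (hz : z * q = z) :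
    star y * z = p * (star y * z) * q := by
  conv_lhs => rw [← hy, ← hz, star_mul, hp.star_eq]
  simp only [mul_assoc]

theorem IsMinimalProjection.exists_star_mul_eq_smul (hp : IsMinimalProjection 𝒜 p)
    (hy : y ∈ 𝒜) (hyp : y * p = y) (hz : z ∈ 𝒜) (hzp : z * p = z) :
    ∃ c : R, star y * z = c • p := by
  rw [star_mul_eq_mul_star_mul_mul hp.isStarProjection.isSelfAdjoint hyp hzp]
  exact hp.exists_eq_smul _ (mul_mem (star_mem hy) hz)

theorem IsColumnBasis.nonempty [Fintype κ] [DecidableEq κ] {x : κ → A}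
    (hx : IsColumnBasis 𝒜 p x) (hp : IsMinimalProjection 𝒜 p) : Nonempty κ := by
  refine not_isEmpty_iff.1 fun _ => hp.ne_zero ?_
  rw [← hx.sum_mul_star_mul p hp.mem hp.isStarProjection.isIdempotentElem.eq,
    Finset.univ_eq_empty, Finset.sum_empty]

namespace IsCompleteFamily

variable {p : κ → A} (hp : IsCompleteFamily 𝒜 p)
include hp

theorem star_mul_eq_zero {i j : κ} (hij : i ≠ j) (hy : y ∈ 𝒜) (hyp : y * p i = y) (hz : z ∈ 𝒜)
    (hzp : z * p j = z) : star y * z = 0 := by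
  rw [star_mul_eq_mul_star_mul_mul (hp.isMinimalProjection i).isStarProjection.isSelfAdjoint
    hyp hzp]
  exact hp.mul_mul_eq_zero i j hij _ (mul_mem (star_mem hy) hz)

variable {ν : κ → Type*} [Fintype κ] [∀ i, Fintype (ν i)] [∀ i, DecidableEq (ν i)]
  {x : ∀ i, ν i → A} (hx : ∀ i, IsColumnBasis 𝒜 (p i) (x i))
include hx

theorem sum_mul_star_mul_eq_self_of_mul_eq_self {i : κ} (hy : y ∈ 𝒜) (hyp : y * p i = y) :
    (∑ j, ∑ k, x j k * star (x j k)) * y = y := by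
  simp only [Finset.sum_mul, mul_assoc]
  rw [Finset.sum_eq_single_of_mem i (Finset.mem_univ i) fun j _ hj => ?_,
    (hx i).sum_mul_star_mul y hy hyp]
  refine Finset.sum_eq_zero fun k _ => ?_
  rw [hp.star_mul_eq_zero hj ((hx j).mem k) ((hx j).mul_eq_self k) hy hyp, mul_zero]

theorem sum_mul_star_mul_eq_self (hy : y ∈ 𝒜) :
    (∑ j, ∑ k, x j k * star (x j k)) * y = y := by
  have hsum : ∑ j, ∑ k, x j k * star (x j k) ∈ 𝒜 :=
    sum_mem fun j _ => sum_mem fun k _ => mul_mem ((hx j).mem k) (star_mem ((hx j).mem k))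
  refine (sub_eq_zero.1 (hp.eq_zero _ (sub_mem hy (mul_mem hsum hy)) fun i b hb => ?_)).symm
  have hpi := hp.isMinimalProjection i
  have hmem : y * b * p i ∈ 𝒜 := mul_mem (mul_mem hy hb) hpi.mem
  have hmul : y * b * p i * p i = y * b * p i := by
    rw [mul_assoc _ (p i), hpi.isStarProjection.isIdempotentElem.eq]
  have hfix := hp.sum_mul_star_mul_eq_self_of_mul_eq_self hx hmem hmul
  rw [sub_mul, sub_mul, mul_assoc _ y b, mul_assoc _ (y * b), hfix, sub_self]

end IsCompleteFamily

end MinimalProjections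

section MatrixAlgebras

open Matrix
open scoped ComplexOrder

variable {ι : Type*} [Fintype ι]

theorem exists_ne_zero_forall_mul_mul_eq_smul {K : Type*} [Field K] [IsAlgClosed K]
    {𝒜 : NonUnitalSubalgebra K (Matrix ι ι K)} {a : Matrix ι ι K} (ha : a ∈ 𝒜) (ha₀ : a ≠ 0) :
    ∃ x ∈ 𝒜, x ≠ 0 ∧ ∀ b ∈ 𝒜, ∃ c : K, x * b * x = c • x := by
  obtain ⟨x, ⟨hx, hx₀⟩, hmin⟩ :=
    exists_minimalFor_of_wellFoundedLT (fun x => x ∈ 𝒜 ∧ x ≠ 0) Matrix.rank ⟨a, ha, ha₀⟩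
  refine ⟨x, hx, hx₀, fun b hb => ?_⟩
  obtain ⟨c, hc⟩ := exists_rank_mul_mul_sub_smul_lt hx₀ b
  refine ⟨c, sub_eq_zero.1 (by_contra fun hne => hc.not_ge (hmin ⟨?_, hne⟩ hc.le))⟩
  exact sub_mem (mul_mem (mul_mem hx hb) hx) (SMulMemClass.smul_mem c hx)

variable {𝕜 : Type*} [RCLike 𝕜] {𝒜 : NonUnitalStarSubalgebra 𝕜 (Matrix ι ι 𝕜)} {p : Matrix ι ι 𝕜}

theorem isMinimalProjection_inv_smul {h : Matrix ι ι 𝕜} {c : 𝕜} (hmem : h ∈ 𝒜) (hh₀ : h ≠ 0)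
    (hstar : hᴴ = h) (hsq : h * h = c • h) (hcorner : ∀ b ∈ 𝒜, ∃ c' : 𝕜, h * b * h = c' • h) :
    IsMinimalProjection 𝒜 (c⁻¹ • h) := by
  have hc₀ : c ≠ 0 := by
    rintro rfl
    exact hh₀ (conjTranspose_mul_self_eq_zero.1 (by rw [hstar, hsq, zero_smul]))
  have hc_real : star c = c := by
    have := congrArg conjTranspose hsq
    rw [conjTranspose_mul, conjTranspose_smul, hstar, hsq] at this
    exact (smul_left_injective 𝕜 hh₀ this).symm
  refine ⟨SMulMemClass.smul_mem _ hmem, smul_ne_zero (inv_ne_zero hc₀) hh₀, ⟨?_, ?_⟩,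
    fun b hb => ?_⟩
  · rw [IsIdempotentElem, smul_mul_smul_comm, hsq, smul_smul, inv_mul_cancel_right₀ hc₀]
  · rw [IsSelfAdjoint, star_smul, star_inv₀, hc_real, star_eq_conjTranspose, hstar]
  · obtain ⟨c', hc'⟩ := hcorner b hb
    refine ⟨c⁻¹ * c', ?_⟩
    rw [smul_mul_assoc, smul_mul_smul_comm, hc', smul_smul, smul_smul, mul_right_comm]

/-- The annihilator in `𝒜` of the two-sided ideal generated by `s`. -/
def idealAnnihilator (𝒜 : NonUnitalStarSubalgebra 𝕜 (Matrix ι ι 𝕜)) (s : Set (Matrix ι ι 𝕜)) :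
    NonUnitalStarSubalgebra 𝕜 (Matrix ι ι 𝕜) where
  carrier := {a | a ∈ 𝒜 ∧ ∀ p ∈ s, ∀ b ∈ 𝒜, a * b * p = 0}
  add_mem' ha ha' := ⟨add_mem ha.1 ha'.1, fun p hp b hb => by
    rw [add_mul, add_mul, ha.2 p hp b hb, ha'.2 p hp b hb, add_zero]⟩
  zero_mem' := ⟨zero_mem _, fun p _ b _ => by rw [zero_mul, zero_mul]⟩
  mul_mem' {a a'} ha ha' := ⟨mul_mem ha.1 ha'.1, fun p hp b hb => by
    rw [mul_assoc a, mul_assoc a, ha'.2 p hp b hb, mul_zero]⟩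
  smul_mem' c a ha := ⟨SMulMemClass.smul_mem c ha.1, fun p hp b hb => by
    rw [smul_mul_assoc, smul_mul_assoc, ha.2 p hp b hb, smul_zero]⟩
  star_mem' {a} ha := ⟨star_mem ha.1, fun p hp b hb => by
    have hsq : (star a * b * p)ᴴ * (star a * b * p) = pᴴ * bᴴ * (a * (star a * b) * p) := by
      simp only [star_eq_conjTranspose, conjTranspose_mul, conjTranspose_conjTranspose, mul_assoc]
    rw [← conjTranspose_mul_self_eq_zero, hsq, ha.2 p hp _ (mul_mem (star_mem ha.1) hb),
      mul_zero]⟩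

theorem mul_mem_idealAnnihilator {s : Set (Matrix ι ι 𝕜)} {a b : Matrix ι ι 𝕜}
    (ha : a ∈ idealAnnihilator 𝒜 s) (hb : b ∈ 𝒜) : a * b ∈ idealAnnihilator 𝒜 s :=
  ⟨mul_mem ha.1 hb, fun p hp c hc => by rw [mul_assoc a b c, ha.2 p hp _ (mul_mem hb hc)]⟩

theorem IsMinimalProjection.of_idealAnnihilator {s : Set (Matrix ι ι 𝕜)}
    (hp : IsMinimalProjection (idealAnnihilator 𝒜 s) p) : IsMinimalProjection 𝒜 p where
  mem := hp.mem.1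
  ne_zero := hp.ne_zero
  isStarProjection := hp.isStarProjection
  exists_eq_smul a ha := by
    simpa only [← mul_assoc, hp.isStarProjection.isIdempotentElem.eq] using
      hp.exists_eq_smul (p * a) (mul_mem_idealAnnihilator hp.mem ha)

theorem idealAnnihilator_insert_lt {s : Set (Matrix ι ι 𝕜)}
    (hp : IsMinimalProjection (idealAnnihilator 𝒜 s) p) :
    idealAnnihilator 𝒜 (insert p s) < idealAnnihilator 𝒜 s := by
  refine SetLike.lt_iff_le_and_exists.2
    ⟨fun a ha => ⟨ha.1, fun q hq => ha.2 q (.inr hq)⟩, p, hp.mem, fun hmem => hp.ne_zero ?_⟩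
  simpa only [hp.isStarProjection.isIdempotentElem.eq] using
    hmem.2 p (Set.mem_insert p s) p hp.mem.1

theorem pairwise_insert_of_isMinimalProjection_idealAnnihilator {s : Set (Matrix ι ι 𝕜)}
    (hs : ∀ q ∈ s, IsMinimalProjection 𝒜 q)
    (hpair : s.Pairwise fun q q' => ∀ a ∈ 𝒜, q * a * q' = 0)
    (hp : IsMinimalProjection (idealAnnihilator 𝒜 s) p) :
    (insert p s).Pairwise fun q q' => ∀ a ∈ 𝒜, q * a * q' = 0 := by
  refine hpair.insert fun q hq _ => ⟨hp.mem.2 q hq, fun a ha => ?_⟩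
  have := congrArg star (hp.mem.2 q hq (star a) (star_mem ha))
  rwa [star_mul, star_mul, star_star, hp.isStarProjection.isSelfAdjoint.star_eq,
    (hs q hq).isStarProjection.isSelfAdjoint.star_eq, star_zero, ← mul_assoc] at this

theorem IsMinimalProjection.exists_conjTranspose_mul_eq_dotProduct_smul
    (hp : IsMinimalProjection 𝒜 p) :
    ∃ v : ι → 𝕜, ∀ y ∈ 𝒜, y * p = y → ∀ z ∈ 𝒜, z * p = z →
      yᴴ * z = (star (y *ᵥ v) ⬝ᵥ z *ᵥ v) • p := by
  obtain ⟨m, V, hV, hVp⟩ := exists_isometry_mul_conjTranspose_eq hp.isStarProjection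
  obtain ⟨k⟩ := nonempty_of_matrix_mul_ne_zero (hVp ▸ hp.ne_zero)
  have hunit : star (Vᵀ k) ⬝ᵥ Vᵀ k = 1 := by
    simpa [mul_apply, dotProduct] using congrFun₂ hV k k
  have hfix : p *ᵥ Vᵀ k = Vᵀ k := by
    have hpV : p * V = V := by rw [← hVp, Matrix.mul_assoc, hV, Matrix.mul_one]
    exact funext fun i => congrFun₂ hpV i k
  refine ⟨Vᵀ k, fun y hy hyp z hz hzp => ?_⟩
  obtain ⟨c, hc⟩ := hp.exists_star_mul_eq_smul hy hyp hz hzp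
  rw [star_eq_conjTranspose] at hc
  rw [star_mulVec, ← dotProduct_mulVec, mulVec_mulVec, hc, smul_mulVec, hfix, dotProduct_smul,
    hunit, smul_eq_mul, mul_one]

theorem IsMinimalProjection.exists_isColumnBasis (hp : IsMinimalProjection 𝒜 p) :
    ∃ (n : ℕ) (x : Fin n → Matrix ι ι 𝕜), IsColumnBasis 𝒜 p x := by
  obtain ⟨v, hv⟩ := hp.exists_conjTranspose_mul_eq_dotProduct_smul
  let L : Submodule 𝕜 (Matrix ι ι 𝕜) :=
    { carrier := {y | y ∈ 𝒜 ∧ y * p = y}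
      add_mem' := fun hy hz => ⟨add_mem hy.1 hz.1, by rw [add_mul, hy.2, hz.2]⟩
      zero_mem' := ⟨zero_mem 𝒜, zero_mul p⟩
      smul_mem' := fun c y hy => ⟨SMulMemClass.smul_mem c hy.1, by rw [smul_mul_assoc, hy.2]⟩ }
  obtain ⟨n, V, hV, hrange, hproj⟩ :=
    exists_isometry_range_eq_submodule (L.map ((mulVecBilin 𝕜 𝕜).flip v))
  choose x hxL hxV using hrange
  replace hxV (k) : x k *ᵥ v = Vᵀ k := hxV k
  refine ⟨n, x, fun k => (hxL k).1, fun k => (hxL k).2, fun k l => ?_, fun y hy hyp => ?_⟩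
  · rw [star_eq_conjTranspose, hv _ (hxL k).1 (hxL k).2 _ (hxL l).1 (hxL l).2, hxV, hxV]
    rw [show star (Vᵀ k) ⬝ᵥ Vᵀ l = (Vᴴ * V) k l from rfl, hV, one_apply, ite_smul, one_smul,
      zero_smul]
  · have hcoord (k) : x k * (star (x k) * y) = (Vᴴ *ᵥ (y *ᵥ v)) k • x k := by
      rw [star_eq_conjTranspose, hv _ (hxL k).1 (hxL k).2 _ hy hyp, mul_smul_comm, (hxL k).2, hxV]
      rfl
    have hmem : y - ∑ k, x k * (star (x k) * y) ∈ L := by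
      simp only [hcoord]
      exact sub_mem ⟨hy, hyp⟩ (sum_mem fun k _ => L.smul_mem _ (hxL k))
    have hker : (y - ∑ k, x k * (star (x k) * y)) *ᵥ v = 0 := by
      have hexp := hproj (y *ᵥ v) ⟨y, ⟨hy, hyp⟩, rfl⟩
      rw [mulVec_eq_sum] at hexp
      simp only [op_smul_eq_smul] at hexp
      simp only [hcoord, sub_mulVec, sum_mulVec, smul_mulVec, hxV, hexp, sub_self]
    rw [eq_comm, ← sub_eq_zero, ← conjTranspose_mul_self_eq_zero,
      hv _ hmem.1 hmem.2 _ hmem.1 hmem.2, hker, dotProduct_zero, zero_smul]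

theorem exists_isMinimalProjection {𝒜 : NonUnitalStarSubalgebra ℂ (Matrix ι ι ℂ)}
    {a : Matrix ι ι ℂ} (ha : a ∈ 𝒜) (ha₀ : a ≠ 0) : ∃ p, IsMinimalProjection 𝒜 p := by
  obtain ⟨x, hx, hx₀, hsmul⟩ :=
    exists_ne_zero_forall_mul_mul_eq_smul (𝒜 := 𝒜.toNonUnitalSubalgebra) ha ha₀
  have hx_star : xᴴ ∈ 𝒜 := star_mem (s := 𝒜) hx
  have hcorner (b) (hb : b * xᴴ ∈ 𝒜) : ∃ c : ℂ, xᴴ * x * b * (xᴴ * x) = c • (xᴴ * x) := by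
    obtain ⟨c, hc⟩ := hsmul (b * xᴴ) hb
    refine ⟨c, ?_⟩
    rw [← Matrix.mul_smul, ← hc]
    simp only [Matrix.mul_assoc]
  classical
  obtain ⟨c, hc⟩ := hcorner 1 (by rwa [Matrix.one_mul])
  rw [Matrix.mul_one] at hc
  exact ⟨c⁻¹ • (xᴴ * x), isMinimalProjection_inv_smul (mul_mem hx_star hx)
    (conjTranspose_mul_self_eq_zero.not.2 hx₀) (isHermitian_conjTranspose_mul_self x) hc
    fun b hb => hcorner b (mul_mem hb hx_star)⟩

theorem exists_isCompleteFamily (𝒜 : NonUnitalStarSubalgebra ℂ (Matrix ι ι ℂ)) :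
    ∃ (N : ℕ) (p : Fin N → Matrix ι ι ℂ), IsCompleteFamily 𝒜 p := by
  classical
  obtain ⟨s, ⟨hs, hpair⟩, hmin⟩ := exists_minimalFor_of_wellFoundedLT
    (fun s : Finset (Matrix ι ι ℂ) => (∀ q ∈ s, IsMinimalProjection 𝒜 q) ∧
      (s : Set (Matrix ι ι ℂ)).Pairwise fun q q' => ∀ a ∈ 𝒜, q * a * q' = 0)
    (fun s => Module.finrank ℂ
      (idealAnnihilator 𝒜 (s : Set (Matrix ι ι ℂ))).toNonUnitalSubalgebra.toSubmodule)
    ⟨∅, by simp⟩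
  refine ⟨s.card, fun i => s.equivFin.symm i, fun i => hs _ (s.equivFin.symm i).2,
    fun i j hij => hpair (s.equivFin.symm i).2 (s.equivFin.symm j).2
      (by simpa [Subtype.ext_iff] using hij), fun a ha hzero => by_contra fun ha₀ => ?_⟩
  have ha_mem : a ∈ idealAnnihilator 𝒜 s := ⟨ha, fun q hq => by
    simpa using hzero (s.equivFin ⟨q, hq⟩)⟩
  obtain ⟨p, hp⟩ := exists_isMinimalProjection ha_mem ha₀
  have hlt := Submodule.finrank_lt_finrank_of_lt
    (s := (idealAnnihilator 𝒜 (insert p s)).toNonUnitalSubalgebra.toSubmodule)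
    (t := (idealAnnihilator 𝒜 s).toNonUnitalSubalgebra.toSubmodule)
    (idealAnnihilator_insert_lt hp)
  rw [← Finset.coe_insert] at hlt
  refine hlt.not_ge (hmin ⟨?_, ?_⟩ hlt.le)
  · simpa using ⟨hp.of_idealAnnihilator, hs⟩
  · rw [Finset.coe_insert]
    exact pairwise_insert_of_isMinimalProjection_idealAnnihilator hs hpair hp

end MatrixAlgebras

section BlockIsometry

open Matrix

theorem mul_blockDiagonal'_mul {R ι ι' κ : Type*} {m n : κ → Type*} [NonUnitalSemiring R]
    [Fintype κ] [DecidableEq κ] [∀ i, Fintype (m i)] [∀ i, Fintype (n i)]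
    (W : Matrix ι (Σ i, m i) R) (D : ∀ i, Matrix (m i) (n i) R) (W' : Matrix (Σ i, n i) ι' R) :
    W * blockDiagonal' D * W' =
      ∑ i, W.submatrix id (Sigma.mk i) * D i * W'.submatrix (Sigma.mk i) id := by
  have hcol (a : ι) (i : κ) (k : n i) :
      (W * blockDiagonal' D) a ⟨i, k⟩ = (W.submatrix id (Sigma.mk i) * D i) a k := by
    rw [mul_apply, Fintype.sum_sigma, Finset.sum_eq_single_of_mem i (Finset.mem_univ i)]
    · simp only [blockDiagonal'_apply_eq, mul_apply, submatrix_apply, id]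
    · intro j _ hj
      simp only [blockDiagonal'_apply_ne _ _ _ hj, mul_zero, Finset.sum_const_zero]
  ext a b
  rw [mul_apply, Fintype.sum_sigma, Matrix.sum_apply]
  simp only [hcol]
  rfl

theorem mul_one_kronecker_mul_conjTranspose {R ι μ ν : Type*} [CommSemiring R] [StarRing R]
    [Fintype μ] [DecidableEq μ] [Fintype ν] (y : ν → Matrix ι μ R) (X : Matrix ν ν R) :
    (of fun a s => y s.2 a s.1 : Matrix ι (μ × ν) R) * ((1 : Matrix μ μ R) ⊗ₖ X) *
        (of fun a s => y s.2 a s.1 : Matrix ι (μ × ν) R)ᴴ =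
      ∑ k, ∑ l, X k l • (y k * (y l)ᴴ) := by
  have hcol (a : ι) (α : μ) (l : ν) :
      ((of fun a s => y s.2 a s.1 : Matrix ι (μ × ν) R) * ((1 : Matrix μ μ R) ⊗ₖ X)) a (α, l) =
        ∑ k, y k a α * X k l := by
    simp only [mul_apply, of_apply, kroneckerMap_apply, one_apply, Fintype.sum_prod_type_right,
      ite_mul, one_mul, zero_mul, mul_ite, mul_zero, Finset.sum_ite_eq', Finset.mem_univ, if_true]
  ext a b
  rw [mul_apply, Fintype.sum_prod_type_right]
  simp only [hcol, conjTranspose_apply, of_apply, Matrix.sum_apply, Matrix.smul_apply, smul_eq_mul,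
    mul_apply, Finset.sum_mul, Finset.mul_sum]
  conv_rhs => rw [Finset.sum_comm]
  refine Finset.sum_congr rfl fun l _ => ?_
  rw [Finset.sum_comm]
  simp only [mul_left_comm, mul_assoc]

variable {R ι κ : Type*} {μ ν : κ → Type*} [CommRing R] [StarRing R] [Fintype ι]

/-- The matrix whose column with index `(i, a, k)` is `x i k` applied to the column `a` of `V i`.
For column bases `x i` of projections `p i = V i * (V i)ᴴ` these columns are orthonormal, and they
bring the algebra into block form. -/
def blockIsometry (x : ∀ i, ν i → Matrix ι ι R) (V : ∀ i, Matrix ι (μ i) R) :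
    Matrix ι (Σ i, μ i × ν i) R :=
  of fun a s => (x s.1 s.2.2 * V s.1) a s.2.1

theorem conjTranspose_blockIsometry_mul_mul_apply (x : ∀ i, ν i → Matrix ι ι R)
    (V : ∀ i, Matrix ι (μ i) R) (a : Matrix ι ι R) (s t : Σ i, μ i × ν i) :
    ((blockIsometry x V)ᴴ * a * blockIsometry x V) s t =
      ((V s.1)ᴴ * ((x s.1 s.2.2)ᴴ * a * x t.1 t.2.2) * V t.1) s.2.1 t.2.1 := by
  have : (V s.1)ᴴ * ((x s.1 s.2.2)ᴴ * a * x t.1 t.2.2) * V t.1 =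
      (x s.1 s.2.2 * V s.1)ᴴ * a * (x t.1 t.2.2 * V t.1) := by
    simp only [conjTranspose_mul, Matrix.mul_assoc]
  rw [this]
  simp only [mul_apply, blockIsometry, conjTranspose_apply, of_apply]

variable [DecidableEq κ] [∀ i, Fintype (μ i)] [∀ i, DecidableEq (μ i)]

theorem conjTranspose_blockIsometry_mul_mul_eq_blockDiagonal' {x : ∀ i, ν i → Matrix ι ι R}
    {V : ∀ i, Matrix ι (μ i) R} (hV : ∀ i, (V i)ᴴ * V i = 1) {a : Matrix ι ι R}
    (hoff : ∀ i j, i ≠ j → ∀ k l, (x i k)ᴴ * a * x j l = 0) {X : ∀ i, Matrix (ν i) (ν i) R}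
    (hdiag : ∀ i k l, (x i k)ᴴ * a * x i l = X i k l • (V i * (V i)ᴴ)) :
    (blockIsometry x V)ᴴ * a * blockIsometry x V =
      blockDiagonal' fun i => (1 : Matrix (μ i) (μ i) R) ⊗ₖ X i := by
  ext ⟨i, α, k⟩ ⟨j, β, l⟩
  rw [conjTranspose_blockIsometry_mul_mul_apply]
  obtain rfl | hij := eq_or_ne i j
  · have hcancel : (V i)ᴴ * (V i * (V i)ᴴ) * V i = 1 := by
      rw [Matrix.mul_assoc, Matrix.mul_assoc, hV, Matrix.mul_one, hV]
    simp only [hdiag, Matrix.mul_smul, Matrix.smul_mul, hcancel, blockDiagonal'_apply_eq,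
      kroneckerMap_apply, Matrix.smul_apply, smul_eq_mul, mul_comm]
  · rw [hoff i j hij, blockDiagonal'_apply_ne _ _ _ hij, Matrix.mul_zero, Matrix.zero_mul,
      Matrix.zero_apply]

variable [∀ i, Fintype (ν i)]

theorem blockIsometry_mul_blockDiagonal'_mul_conjTranspose [Fintype κ]
    (x : ∀ i, ν i → Matrix ι ι R) (V : ∀ i, Matrix ι (μ i) R) (X : ∀ i, Matrix (ν i) (ν i) R) :
    blockIsometry x V * blockDiagonal' (fun i => (1 : Matrix (μ i) (μ i) R) ⊗ₖ X i) *
        (blockIsometry x V)ᴴ =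
      ∑ i, ∑ k, ∑ l, X i k l • (x i k * (V i * (V i)ᴴ) * (x i l)ᴴ) := by
  rw [mul_blockDiagonal'_mul]
  refine Finset.sum_congr rfl fun i _ => ?_
  refine (mul_one_kronecker_mul_conjTranspose (fun k => x i k * V i) (X i)).trans ?_
  simp only [conjTranspose_mul, Matrix.mul_assoc]

variable [∀ i, DecidableEq (ν i)] {𝒜 : NonUnitalStarSubalgebra R (Matrix ι ι R)}
  {p : κ → Matrix ι ι R} {x : ∀ i, ν i → Matrix ι ι R} {V : ∀ i, Matrix ι (μ i) R}

namespace IsCompleteFamily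

variable (hp : IsCompleteFamily 𝒜 p) (hx : ∀ i, IsColumnBasis 𝒜 (p i) (x i))
include hp hx

theorem conjTranspose_blockIsometry_mul_self (hV : ∀ i, (V i)ᴴ * V i = 1)
    (hVp : ∀ i, V i * (V i)ᴴ = p i) : (blockIsometry x V)ᴴ * blockIsometry x V = 1 := by
  classical
  have := conjTranspose_blockIsometry_mul_mul_eq_blockDiagonal' hV (x := x) (a := 1) (X := 1)
    (fun i j hij k l => by
      rw [Matrix.mul_one]
      exact hp.star_mul_eq_zero hij ((hx i).mem k) ((hx i).mul_eq_self k) ((hx j).mem l)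
        ((hx j).mul_eq_self l))
    (fun i k l => by
      rw [Matrix.mul_one, hVp, ← star_eq_conjTranspose, (hx i).star_mul, Pi.one_apply, one_apply,
        ite_smul, one_smul, zero_smul])
  simpa only [Matrix.mul_one, Pi.one_apply, one_kronecker_one, ← Pi.one_def, blockDiagonal'_one]
    using this

theorem exists_conjTranspose_blockIsometry_mul_mul_eq (hV : ∀ i, (V i)ᴴ * V i = 1)
    (hVp : ∀ i, V i * (V i)ᴴ = p i) {a : Matrix ι ι R} (ha : a ∈ 𝒜) :
    ∃ X : ∀ i, Matrix (ν i) (ν i) R, (blockIsometry x V)ᴴ * a * blockIsometry x V =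
      blockDiagonal' fun i => (1 : Matrix (μ i) (μ i) R) ⊗ₖ X i := by
  have hmem (i l) : a * x i l ∈ 𝒜 := mul_mem ha ((hx i).mem l)
  have hmul (i l) : a * x i l * p i = a * x i l := by rw [Matrix.mul_assoc, (hx i).mul_eq_self]
  choose X hX using fun i k l => (hp.isMinimalProjection i).exists_star_mul_eq_smul
    ((hx i).mem k) ((hx i).mul_eq_self k) (hmem i l) (hmul i l)
  refine ⟨X, conjTranspose_blockIsometry_mul_mul_eq_blockDiagonal' hV (fun i j hij k l => ?_)
    fun i k l => ?_⟩
  · rw [Matrix.mul_assoc]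
    exact hp.star_mul_eq_zero hij ((hx i).mem k) ((hx i).mul_eq_self k) (hmem j l) (hmul j l)
  · rw [Matrix.mul_assoc, hVp]
    exact hX i k l

variable [Fintype κ]

omit [DecidableEq κ] [∀ i, DecidableEq (μ i)] in
theorem blockIsometry_mul_conjTranspose_mul (hVp : ∀ i, V i * (V i)ᴴ = p i) {a : Matrix ι ι R}
    (ha : a ∈ 𝒜) : blockIsometry x V * (blockIsometry x V)ᴴ * a = a := by
  classical
  have := blockIsometry_mul_blockDiagonal'_mul_conjTranspose x V 1
  simp only [Pi.one_apply, one_kronecker_one, ← Pi.one_def, blockDiagonal'_one, Matrix.mul_one,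
    one_apply, ite_smul, one_smul, zero_smul, Finset.sum_ite_eq, Finset.mem_univ, if_true, hVp,
    (hx _).mul_eq_self] at this
  rw [this]
  exact hp.sum_mul_star_mul_eq_self hx ha

theorem coe_eq_range_blockIsometry (hV : ∀ i, (V i)ᴴ * V i = 1)
    (hVp : ∀ i, V i * (V i)ᴴ = p i) :
    (𝒜 : Set (Matrix ι ι R)) = Set.range fun X : ∀ i, Matrix (ν i) (ν i) R =>
      blockIsometry x V * blockDiagonal' (fun i => (1 : Matrix (μ i) (μ i) R) ⊗ₖ X i) *
        (blockIsometry x V)ᴴ := by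
  refine Set.Subset.antisymm (fun a ha => ?_) (Set.range_subset_iff.2 fun X => ?_)
  · have hleft := hp.blockIsometry_mul_conjTranspose_mul hx hVp ha
    have hright : a * (blockIsometry x V * (blockIsometry x V)ᴴ) = a := by
      simpa [star_eq_conjTranspose, Matrix.mul_assoc] using
        congrArg star (hp.blockIsometry_mul_conjTranspose_mul hx hVp (star_mem ha))
    obtain ⟨X, hX⟩ := hp.exists_conjTranspose_blockIsometry_mul_mul_eq hx hV hVp ha
    refine ⟨X, ?_⟩
    dsimp only
    rw [← hX, ← Matrix.mul_assoc, ← Matrix.mul_assoc, hleft, Matrix.mul_assoc, hright]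
  · rw [blockIsometry_mul_blockDiagonal'_mul_conjTranspose]
    refine sum_mem fun i _ => sum_mem fun k _ => sum_mem fun l _ => SMulMemClass.smul_mem _ ?_
    rw [hVp, (hx i).mul_eq_self]
    exact mul_mem ((hx i).mem k) (star_mem ((hx i).mem l))

end IsCompleteFamily

end BlockIsometry

section Structure

open Matrix

theorem exists_isometry_coe_eq_range {ι : Type*} [Fintype ι]
    (𝒜 : NonUnitalStarSubalgebra ℂ (Matrix ι ι ℂ)) :
    ∃ (N : ℕ) (m n : Fin N → ℕ) (W : Matrix ι (Σ i, Fin (m i) × Fin (n i)) ℂ),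
      (∀ i, 0 < m i ∧ 0 < n i) ∧ Wᴴ * W = 1 ∧
      (𝒜 : Set (Matrix ι ι ℂ)) = Set.range fun X : ∀ i, Matrix (Fin (n i)) (Fin (n i)) ℂ =>
        W * blockDiagonal' (fun i => (1 : Matrix (Fin (m i)) (Fin (m i)) ℂ) ⊗ₖ X i) * Wᴴ := by
  obtain ⟨N, p, hp⟩ := exists_isCompleteFamily 𝒜
  choose m V hV hVp using fun i =>
    exists_isometry_mul_conjTranspose_eq (hp.isMinimalProjection i).isStarProjection
  choose n x hx using fun i => (hp.isMinimalProjection i).exists_isColumnBasis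
  refine ⟨N, m, n, blockIsometry x V, fun i => ⟨?_, ?_⟩,
    hp.conjTranspose_blockIsometry_mul_self hx hV hVp, hp.coe_eq_range_blockIsometry hx hV hVp⟩
  · exact Fin.pos_iff_nonempty.2
      (nonempty_of_matrix_mul_ne_zero (hVp i ▸ (hp.isMinimalProjection i).ne_zero))
  · exact Fin.pos_iff_nonempty.2 ((hx i).nonempty (hp.isMinimalProjection i))

end Structure

section BlockForm

open Matrix

theorem one_kronecker_inj {R μ ν : Type*} [MulZeroOneClass R] [DecidableEq μ] [Nonempty μ]
    {X Y : Matrix ν ν R} : (1 : Matrix μ μ R) ⊗ₖ X = (1 : Matrix μ μ R) ⊗ₖ Y ↔ X = Y := by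
  refine ⟨fun h => Matrix.ext fun k l => ?_, fun h => h ▸ rfl⟩
  obtain ⟨α⟩ := ‹Nonempty μ›
  simpa using congrFun₂ h (α, k) (α, l)

theorem star_mul_mul_coe_comm_iff {A : Type*} [Ring A] [StarRing A] (u : unitary A) {b c : A} :
    star (u : A) * b * u * (star (u : A) * c * u) = star (u : A) * c * u * (star (u : A) * b * u) ↔
      b * c = c * b := by
  simp only [← Unitary.conjStarAlgAut_symm_apply (S := ℤ), ← map_mul, EmbeddingLike.apply_eq_iff_eq]

variable {d N d₀ : ℕ} {m n : Fin N → ℕ} {hd : ∑ i, n i * m i + d₀ = d}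
  {X Y : ∀ i, Matrix (Fin (n i)) (Fin (n i)) ℂ}

theorem blockSum_mul_blockSum :
    blockSum m n hd X * blockSum m n hd Y = blockSum m n hd fun i => X i * Y i := by
  unfold blockSum
  rw [reindex_apply, reindex_apply, reindex_apply, submatrix_mul_equiv, fromBlocks_multiply]
  simp only [Matrix.mul_zero, Matrix.zero_mul, add_zero, ← blockDiagonal'_mul,
    ← mul_kronecker_mul, Matrix.mul_one]

theorem blockSum_eq_blockSum_iff :
    blockSum m n hd X = blockSum m n hd Y ↔ ∀ i, 0 < m i → X i = Y i := by
  unfold blockSum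
  rw [(reindex _ _).apply_eq_iff_eq, fromBlocks_inj, blockDiagonal'_inj]
  simp only [and_true, funext_iff]
  refine forall_congr' fun i => ?_
  obtain hm | hm := (m i).eq_zero_or_pos
  · have : IsEmpty (Fin (m i)) := by rw [hm]; infer_instance
    simp only [hm, lt_irrefl, IsEmpty.forall_iff, iff_true]
    ext ⟨α, _⟩
    exact isEmptyElim α
  · have := Fin.pos_iff_nonempty.1 hm
    rw [one_kronecker_inj]
    simp only [hm, true_imp_iff]

theorem forall_blockSum_comm_iff :
    (∀ Y, blockSum m n hd X * blockSum m n hd Y = blockSum m n hd Y * blockSum m n hd X) ↔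
      ∃ α : Fin N → ℂ, blockSum m n hd X = blockSum m n hd fun i => α i • 1 := by
  constructor
  · intro h
    have hscalar (i) (hm : 0 < m i) : X i ∈ Set.range (scalar (Fin (n i))) := by
      rw [← center_eq_range, Semigroup.mem_center_iff]
      intro Z
      have := h (Pi.single i Z)
      rw [blockSum_mul_blockSum, blockSum_mul_blockSum, blockSum_eq_blockSum_iff] at this
      simpa using (this i hm).symm
    choose! α hα using hscalar
    exact ⟨α, blockSum_eq_blockSum_iff.2 fun i hm => by
      rw [← hα i hm, scalar_apply, smul_one_eq_diagonal]⟩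
  · rintro ⟨α, hα⟩ Y
    simp only [hα, blockSum_mul_blockSum, smul_mul_assoc, mul_smul_comm, Matrix.one_mul,
      Matrix.mul_one]

variable {𝒜 : NonUnitalStarSubalgebra ℂ (Matrix (Fin d) (Fin d) ℂ)} {U : unitaryGroup (Fin d) ℂ}

theorem isBlockDecomposition_iff :
    IsBlockDecomposition 𝒜 U m n hd ↔ (𝒜 : Set (Matrix (Fin d) (Fin d) ℂ)) =
      Set.range fun X => (U : Matrix (Fin d) (Fin d) ℂ)ᴴ * blockSum m n hd X * U := by
  let φ := Unitary.conjStarAlgAut ℂ (Matrix (Fin d) (Fin d) ℂ) U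
  have h := φ.toEquiv.eq_image_iff_symm_image_eq (𝒜 : Set _) (Set.range (blockSum m n hd))
  rw [← Set.range_comp] at h
  exact eq_comm.trans (h.trans eq_comm)

theorem IsBlockDecomposition.algebraCenter_eq (h : IsBlockDecomposition 𝒜 U m n hd) :
    algebraCenter 𝒜 = {A | ∃ α : Fin N → ℂ, A = (U : Matrix (Fin d) (Fin d) ℂ)ᴴ *
      blockSum m n hd (fun i => α i • (1 : Matrix (Fin (n i)) (Fin (n i)) ℂ)) *
      (U : Matrix (Fin d) (Fin d) ℂ)} := by
  rw [isBlockDecomposition_iff, Set.ext_iff] at h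
  ext A
  constructor
  · rintro ⟨hA, hcomm⟩
    obtain ⟨X, rfl⟩ := (h A).1 hA
    obtain ⟨α, hα⟩ := forall_blockSum_comm_iff.1 fun Y =>
      (star_mul_mul_coe_comm_iff U).1 (hcomm _ ((h _).2 ⟨Y, rfl⟩))
    exact ⟨α, by rw [← hα]⟩
  · rintro ⟨α, rfl⟩
    refine ⟨(h _).2 ⟨_, rfl⟩, fun B hB => ?_⟩
    obtain ⟨Y, rfl⟩ := (h B).1 hB
    exact (star_mul_mul_coe_comm_iff U).2 (forall_blockSum_comm_iff.2 ⟨α, rfl⟩ Y)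

theorem exists_isBlockDecomposition (𝒜 : NonUnitalStarSubalgebra ℂ (Matrix (Fin d) (Fin d) ℂ)) :
    ∃ (N d₀ : ℕ) (m n : Fin N → ℕ) (hd : ∑ i, n i * m i + d₀ = d) (U : unitaryGroup (Fin d) ℂ),
      (∀ i, 0 < m i ∧ 0 < n i) ∧ IsBlockDecomposition 𝒜 U m n hd := by
  obtain ⟨N, m, n, W, hpos, hW, h𝒜⟩ := exists_isometry_coe_eq_range 𝒜
  have hle : ∑ i, n i * m i ≤ d := by
    simpa [mul_comm] using card_le_of_conjTranspose_mul_self_eq_one hW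
  have hd := Nat.add_sub_of_le hle
  obtain ⟨U, hU⟩ := exists_unitary_conj_fromBlocks_eq (blockIndexEquiv m n hd) hW
  refine ⟨N, _, m, n, hd, U, hpos, isBlockDecomposition_iff.2 (h𝒜.trans ?_)⟩
  exact congrArg Set.range (funext fun X => (hU _).symm)

end BlockForm

theorem mainTheorem1 (d : ℕ) (𝒜 : NonUnitalStarSubalgebra ℂ (Matrix (Fin d) (Fin d) ℂ)) :
    (∃ (N d₀ : ℕ) (m n : Fin N → ℕ) (hd : ∑ i, n i * m i + d₀ = d)
        (U : Matrix.unitaryGroup (Fin d) ℂ),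
      (∀ i, 0 < m i ∧ 0 < n i) ∧ IsBlockDecomposition 𝒜 U m n hd) ∧
    (∀ (N d₀ : ℕ) (m n : Fin N → ℕ) (hd : ∑ i, n i * m i + d₀ = d)
        (U : Matrix.unitaryGroup (Fin d) ℂ),
      IsBlockDecomposition 𝒜 U m n hd →
        algebraCenter 𝒜 =
          {A | ∃ α : Fin N → ℂ,
            A = (U : Matrix (Fin d) (Fin d) ℂ)ᴴ *
              blockSum m n hd (fun i => α i • (1 : Matrix (Fin (n i)) (Fin (n i)) ℂ)) *
              (U : Matrix (Fin d) (Fin d) ℂ)}) :=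
  ⟨exists_isBlockDecomposition 𝒜, fun _ _ _ _ _ _ h => h.algebraCenter_eq⟩
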